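/- All spaces are metric. A metric space $X$ is *uniformly locally connected* (ULC) if for every $\varepsilon>0$ there is $\delta>0$ such that any two points of $X$ at distance $<\delta$ lie in a connected subset of $X$ of diameter $<\varepsilon$. It is *straight* if, whenever $X$ is the union of finitely many closed sets, a continuous function $f\colon X\to\mathbb R$ is uniformly continuous if and only if its restriction to each of these closed sets is uniformly continuous. It is *precompact* if it is totally bounded. **Theorem B.** For each $n\in\mathbb N$ let $(X_n,d_n)$ be a nonempty ULC metric space, and let $X=\prod_{n\in\mathbb N}X_n$ be equipped with the metric $$d(x,y)=\sum_{n\in\mathbb N}\frac1{2^n}\min\{1,d_n(x_n,y_n)\}.$$ (This is $\sum_n 2^{-n}d_n(x_n,y_n)$ when all $d_n$ are bounded by $1$.) (a) $X$ is ULC if and only if all but finitely many of the spaces $X_n$ are connected. (b) The following are equivalent: - (b$_1$) $X$ is straight; - (b$_2$) either $X$ is ULC or every $X_n$ is precompact. -/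

import Mathlib

open Set

universe u

/-- A metric space is uniformly locally connected (ULC) if for every `ε > 0` there is `δ > 0` such
that any two points at distance `< δ` lie in a connected set of diameter `< ε`.  The diameter is
taken in `[0, ∞]`, so that an unbounded set has infinite diameter. -/
def IsULC (X : Type u) [MetricSpace X] : Prop :=
  ∀ ε : ℝ, 0 < ε → ∃ δ : ℝ, 0 < δ ∧ ∀ x y : X, dist x y < δ →
    ∃ C : Set X, IsConnected C ∧ x ∈ C ∧ y ∈ C ∧ Metric.ediam C < ENNReal.ofReal ε

/-- A metric space `X` is straight if, whenever `X` is the union of finitely many closed sets,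
a continuous function `f : X → ℝ` is uniformly continuous if and only if its restriction to each of
these closed sets is uniformly continuous. -/
def IsStraight (X : Type u) [MetricSpace X] : Prop :=
  ∀ F : Set (Set X), F.Finite → (∀ C ∈ F, IsClosed C) → ⋃₀ F = univ →
    ∀ f : X → ℝ, Continuous f → (UniformContinuous f ↔ ∀ C ∈ F, UniformContinuousOn f C)

/-- A metric space is precompact if it is totally bounded, i.e. for each `ε > 0` it is covered by
finitely many balls of radius `ε`. -/
def IsPrecompact (X : Type u) [MetricSpace X] : Prop :=
  TotallyBounded (univ : Set X)

/-- The product of a sequence of metric spaces, with the metric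
`d (x, y) = ∑ n, 2⁻ⁿ * min 1 (dₙ (xₙ, yₙ))`. -/
def SeqProd (X : ℕ → Type u) : Type u := ∀ n, X n

namespace SeqProd

variable {X : ℕ → Type u} [∀ n, MetricSpace (X n)]

noncomputable instance instDist : Dist (SeqProd X) where
  dist x y := ∑' n : ℕ, (1 / 2 : ℝ) ^ n * min 1 (dist (x n) (y n))

theorem dist_def (x y : SeqProd X) :
    dist x y = ∑' n : ℕ, (1 / 2 : ℝ) ^ n * min 1 (dist (x n) (y n)) := rfl

theorem term_nonneg (x y : SeqProd X) (n : ℕ) :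
    0 ≤ (1 / 2 : ℝ) ^ n * min 1 (dist (x n) (y n)) := by positivity

theorem summable (x y : SeqProd X) :
    Summable fun n : ℕ => (1 / 2 : ℝ) ^ n * min 1 (dist (x n) (y n)) :=
  .of_nonneg_of_le (term_nonneg x y)
    (fun _ => mul_le_of_le_one_right (by positivity) (min_le_left _ _)) summable_geometric_two

theorem term_le_dist (x y : SeqProd X) (n : ℕ) :
    (1 / 2 : ℝ) ^ n * min 1 (dist (x n) (y n)) ≤ dist x y :=
  (summable x y).le_tsum n fun j _ => term_nonneg x y j

noncomputable instance instMetricSpace : MetricSpace (SeqProd X) where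
  dist_self x := by simp [dist_def]
  dist_comm x y := by simp [dist_def, dist_comm]
  dist_triangle x y z := by
    simp only [dist_def]
    rw [← (summable x y).tsum_add (summable y z)]
    refine (summable x z).tsum_le_tsum (fun n => ?_) ((summable x y).add (summable y z))
    rw [← mul_add]
    refine mul_le_mul_of_nonneg_left ?_ (by positivity)
    have h := dist_triangle (x n) (y n) (z n)
    have h1 : 0 ≤ dist (x n) (y n) := dist_nonneg
    have h2 : 0 ≤ dist (y n) (z n) := dist_nonneg
    grind
  eq_of_dist_eq_zero {x y} h := by
    funext n
    have h1 := term_le_dist x y n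
    rw [h] at h1
    have h2 : min 1 (dist (x n) (y n)) ≤ 0 := by
      by_contra! h3
      exact absurd h1 (not_le.2 (by positivity))
    have h3 : dist (x n) (y n) ≤ 0 := by grind
    exact dist_le_zero.1 h3

end SeqProd

/-! Coordinates from `N` on contribute at most `2 * (1 / 2) ^ N` to the distance. Hence small
connected sets in the first factors times whole connected tail factors form small connected boxes;
conversely, points differing only in a far coordinate are close, and projecting a connected set
joining them connects that factor. For straightness, the key is `exists_forall_isConnected_dist_lt`:
the image of a small connected set is an interval covered by boundedly many short pieces. This
settles the ULC case. In the precompact case, small connected boxes link every point to a compact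
grid of finite nets, where `f` is uniformly continuous. Otherwise `not_isStraight` glues a bump
function and `0` along two closed sets built from a separated sequence in one factor and clopen
splittings of infinitely many others. -/

open Filter Topology MeasureTheory

namespace SeqProd

/-! ### Topology and metric of the product; part (a). -/

section Coordinates

variable {X : ℕ → Type u}

/-- The identity, from the product topology to the topology of the metric. -/
def ofPi (x : ∀ n, X n) : SeqProd X := x

/-- The product of subsets of the factors. -/
def box (C : ∀ n, Set (X n)) : Set (SeqProd X) := {x | ∀ n, x n ∈ C n}

theorem ofPi_image_pi (C : ∀ n, Set (X n)) : ofPi '' univ.pi C = box C := by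
  ext x
  exact ⟨by rintro ⟨y, hy, rfl⟩ n; exact hy n trivial, fun h => ⟨x, fun n _ => h n, rfl⟩⟩

/-- Replace the `n`-th coordinate of `x` by `a`. -/
def update (x : SeqProd X) (n : ℕ) (a : X n) : SeqProd X := Function.update x n a

@[simp]
theorem update_self (x : SeqProd X) (n : ℕ) (a : X n) : update x n a n = a :=
  Function.update_self ..

theorem update_of_ne (x : SeqProd X) {n i : ℕ} (h : i ≠ n) (a : X n) : update x n a i = x i :=
  Function.update_of_ne h ..

end Coordinates

variable {X : ℕ → Type u} [∀ n, MetricSpace (X n)]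

theorem dist_le_of_forall_lt {x y : SeqProd X} {η : ℝ} (N : ℕ) (hη : 0 ≤ η)
    (h : ∀ n < N, dist (x n) (y n) ≤ η) : dist x y ≤ 2 * η + 2 * (1 / 2 : ℝ) ^ N := by
  have h1 : HasSum (fun n : ℕ => (1 / 2 : ℝ) ^ n * η) (2 * η) := hasSum_geometric_two.mul_right η
  have h2 : HasSum (fun n : ℕ => if n < N then 0 else (1 / 2 : ℝ) ^ n) (2 * (1 / 2 : ℝ) ^ N) := by
    rw [← hasSum_nat_add_iff' N, Finset.sum_eq_zero fun i hi => if_pos (Finset.mem_range.1 hi)]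
    simpa [pow_add] using hasSum_geometric_two.mul_right ((1 / 2 : ℝ) ^ N)
  refine hasSum_le (fun n => ?_) (summable x y).hasSum (h1.add h2)
  have hp : (0 : ℝ) < (1 / 2) ^ n := by positivity
  split_ifs with hn
  · rw [add_zero]
    exact mul_le_mul_of_nonneg_left ((min_le_right _ _).trans (h n hn)) hp.le
  · have := mul_le_of_le_one_right hp.le (min_le_left 1 (dist (x n) (y n)))
    have := mul_nonneg hp.le hη
    linarith

theorem exists_two_mul_pow_lt {ε : ℝ} (hε : 0 < ε) : ∃ N : ℕ, ∀ n ≥ N, 2 * (1 / 2 : ℝ) ^ n < ε := by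
  have h : Tendsto (fun n : ℕ => 2 * (1 / 2 : ℝ) ^ n) atTop (𝓝 (2 * 0)) :=
    (tendsto_pow_atTop_nhds_zero_of_lt_one (by norm_num) (by norm_num)).const_mul 2
  rw [mul_zero] at h
  exact eventually_atTop.1 (h.eventually_lt_const hε)

theorem uniformContinuous_eval (n : ℕ) : UniformContinuous fun x : SeqProd X => x n := by
  refine Metric.uniformContinuous_iff.2 fun ε hε =>
    ⟨(1 / 2 : ℝ) ^ n * min 1 ε, by positivity, fun {x y} h => ?_⟩
  have h1 := lt_of_mul_lt_mul_left ((term_le_dist x y n).trans_lt h) (by positivity)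
  grind

theorem exists_pos_forall_lt (N : ℕ) {δ : ℕ → ℝ} (hδ : ∀ n, 0 < δ n) :
    ∃ r > 0, ∀ x y : SeqProd X, dist x y < r → ∀ n < N, dist (x n) (y n) < δ n := by
  have h : ∀ n, ∃ r > 0, ∀ x y : SeqProd X, dist x y < r → dist (x n) (y n) < δ n := fun n => by
    obtain ⟨r, hr, h⟩ := Metric.uniformContinuous_iff.1 (uniformContinuous_eval (X := X) n) _ (hδ n)
    exact ⟨r, hr, fun x y hxy => h hxy⟩
  induction N with
  | zero => exact ⟨1, one_pos, by simp⟩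
  | succ N ih =>
    obtain ⟨r, hr, h1⟩ := ih
    obtain ⟨s, hs, h2⟩ := h N
    refine ⟨min r s, lt_min hr hs, fun x y hxy n hn => ?_⟩
    rcases Nat.lt_succ_iff_lt_or_eq.1 hn with hn | rfl
    · exact h1 x y (hxy.trans_le (min_le_left _ _)) n hn
    · exact h2 x y (hxy.trans_le (min_le_right _ _))

theorem continuous_ofPi : Continuous (ofPi : (∀ n, X n) → SeqProd X) := by
  refine continuous_iff_continuousAt.2 fun x => Metric.tendsto_nhds.2 fun ε hε => ?_
  obtain ⟨N, hN⟩ := exists_two_mul_pow_lt (half_pos hε)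
  have h : ∀ᶠ y : ∀ n, X n in 𝓝 x, ∀ n ∈ Finset.range N, dist (y n) (x n) < ε / 8 :=
    (Finset.eventually_all _).2 fun n _ =>
      Metric.tendsto_nhds.1 ((continuous_apply n).tendsto x) _ (by positivity)
  filter_upwards [h] with y hy
  have := dist_le_of_forall_lt (x := ofPi y) (y := ofPi x) N (by positivity : 0 ≤ ε / 8)
    fun n hn => (hy n (Finset.mem_range.2 hn)).le
  linarith [hN N le_rfl]

theorem isConnected_box {C : ∀ n, Set (X n)} (h : ∀ n, IsConnected (C n)) :
    IsConnected (box C) := by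
  rw [← ofPi_image_pi]
  exact (isConnected_univ_pi.2 h).image _ continuous_ofPi.continuousOn

theorem isCompact_box {C : ∀ n, Set (X n)} (h : ∀ n, IsCompact (C n)) : IsCompact (box C) := by
  rw [← ofPi_image_pi]
  exact (isCompact_univ_pi h).image continuous_ofPi

theorem ediam_box_le {C : ∀ n, Set (X n)} {η : ℝ} (N : ℕ) (hη : 0 ≤ η)
    (h : ∀ n < N, Metric.ediam (C n) < ENNReal.ofReal η) :
    Metric.ediam (box C) ≤ ENNReal.ofReal (2 * η + 2 * (1 / 2 : ℝ) ^ N) := by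
  refine Metric.ediam_le_of_forall_dist_le fun x hx y hy =>
    dist_le_of_forall_lt N hη fun n hn => ?_
  have h1 := (Metric.edist_le_ediam_of_mem (hx n) (hy n)).trans (h n hn).le
  rwa [edist_dist, ENNReal.ofReal_le_ofReal_iff hη] at h1

open Classical in
theorem isULC_of_finite [∀ n, Nonempty (X n)] (hX : ∀ n, IsULC (X n))
    (hfin : {n : ℕ | ¬ ConnectedSpace (X n)}.Finite) : IsULC (SeqProd X) := by
  intro ε hε
  obtain ⟨N₁, hN₁⟩ := exists_two_mul_pow_lt (half_pos hε)
  obtain ⟨N₂, hN₂⟩ := hfin.bddAbove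
  set N := max N₁ (N₂ + 1)
  have hconn : ∀ n ≥ N, ConnectedSpace (X n) := fun n hn => by
    by_contra hc
    have h1 : n ≤ N₂ := hN₂ hc
    have h2 : N₂ + 1 ≤ N := le_max_right _ _
    omega
  choose δ hδ hC using fun n => hX n (ε / 8) (by positivity)
  obtain ⟨r, hr, hrδ⟩ := exists_pos_forall_lt (X := X) N hδ
  refine ⟨r, hr, fun x y hxy => ?_⟩
  have key : ∀ n, ∃ C : Set (X n), IsConnected C ∧ x n ∈ C ∧ y n ∈ C ∧
      (n < N → Metric.ediam C < ENNReal.ofReal (ε / 8)) := fun n => by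
    by_cases hn : n < N
    · obtain ⟨C, h1, h2, h3, h4⟩ := hC n _ _ (hrδ x y hxy n hn)
      exact ⟨C, h1, h2, h3, fun _ => h4⟩
    · have := hconn n (not_lt.1 hn)
      exact ⟨univ, isConnected_univ, trivial, trivial, fun h => absurd h hn⟩
  choose C h1 h2 h3 h4 using key
  refine ⟨box C, isConnected_box h1, h2, h3, (ediam_box_le N (by positivity) h4).trans_lt ?_⟩
  -- The head gives `2 * (ε / 8)`, the tail less than `ε / 2`.
  rw [ENNReal.ofReal_lt_ofReal_iff hε]
  linarith [hN₁ N (le_max_left _ _)]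

theorem dist_update_le (x : SeqProd X) (n : ℕ) (a b : X n) :
    dist (update x n a) (update x n b) ≤ 2 * (1 / 2 : ℝ) ^ n := by
  have := dist_le_of_forall_lt (x := update x n a) (y := update x n b) n le_rfl fun i hi => by
    simp [update_of_ne x hi.ne]
  simpa using this

theorem finite_of_isULC [∀ n, Nonempty (X n)] (h : IsULC (SeqProd X)) :
    {n : ℕ | ¬ ConnectedSpace (X n)}.Finite := by
  obtain ⟨δ, hδ, h⟩ := h 1 one_pos
  obtain ⟨N, hN⟩ := exists_two_mul_pow_lt hδ
  refine (finite_lt_nat N).subset fun n hn => ?_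
  by_contra hlt
  refine hn ?_
  let x : SeqProd X := fun n => Classical.arbitrary (X n)
  have : PreconnectedSpace (X n) := by
    refine ⟨isPreconnected_of_forall_pair fun a _ b _ => ?_⟩
    obtain ⟨C, hC, ha, hb, -⟩ := h _ _ ((dist_update_le x n a b).trans_lt (hN n (not_lt.1 hlt)))
    exact ⟨(fun x : SeqProd X => x n) '' C, subset_univ _, ⟨_, ha, update_self ..⟩,
      ⟨_, hb, update_self ..⟩,
      hC.isPreconnected.image _ (uniformContinuous_eval n).continuous.continuousOn⟩
  exact ⟨inferInstance⟩

end SeqProd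

/-! ### Oscillation on connected sets; ULC spaces are straight. -/

section Oscillation

variable {X : Type u} [MetricSpace X]

/-- A continuous function that is uniformly continuous on each member of a finite cover oscillates
little on connected sets of small diameter. -/
theorem exists_forall_isConnected_dist_lt {F : Set (Set X)} (hF : F.Finite) (hcov : ⋃₀ F = univ)
    {f : X → ℝ} (hf : Continuous f) (huc : ∀ C ∈ F, UniformContinuousOn f C) {ε : ℝ} (hε : 0 < ε) :
    ∃ r > 0, ∀ C : Set X, IsConnected C → Metric.ediam C < ENNReal.ofReal r →
      ∀ x ∈ C, ∀ y ∈ C, dist (f x) (f y) < ε := by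
  set m : ℕ := hF.toFinset.card
  -- With `m + 1` rather than `m`, the total `m * ε'` is strictly below `ε`, even for `m = 0`.
  set ε' : ℝ := ε / (m + 1) with hε'
  have hε'0 : 0 < ε' := by positivity
  have h1 : ∃ r > 0, ∀ A ∈ F, ∀ x ∈ A, ∀ y ∈ A, dist x y < r → dist (f x) (f y) < ε' := by
    have h2 : ∀ᶠ p in uniformity X, ∀ A ∈ F, p.1 ∈ A → p.2 ∈ A → dist (f p.1) (f p.2) < ε' := by
      refine (eventually_all_finite hF).2 fun A hA => ?_
      obtain ⟨δ, hδ, h⟩ := Metric.uniformContinuousOn_iff.1 (huc A hA) ε' hε'0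
      filter_upwards [Metric.dist_mem_uniformity hδ] with p hp h3 h4 using h _ h3 _ h4 hp
    obtain ⟨r, hr, h⟩ := Metric.mem_uniformity_dist.1 h2
    exact ⟨r, hr, fun A hA x hx y hy hxy => h hxy A hA hx hy⟩
  obtain ⟨r, hr, h1⟩ := h1
  refine ⟨r, hr, fun C hC hdiam x hx y hy => ?_⟩
  have hsub : uIcc (f x) (f y) ⊆ ⋃ A ∈ hF.toFinset, f '' (C ∩ A) := by
    have hcon := (hC.isPreconnected.image f hf.continuousOn).ordConnected.uIcc_subset
      (mem_image_of_mem f hx) (mem_image_of_mem f hy)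
    refine hcon.trans ?_
    rintro _ ⟨z, hz, rfl⟩
    obtain ⟨A, hA, hzA⟩ := mem_sUnion.1 (hcov.symm ▸ mem_univ z)
    exact mem_biUnion (hF.mem_toFinset.2 hA) ⟨z, ⟨hz, hzA⟩, rfl⟩
  -- The pieces need be neither connected nor measurable: outer measure is bounded by diameter and
  -- is subadditive.
  have hpiece : ∀ A ∈ hF.toFinset, volume (f '' (C ∩ A)) ≤ ENNReal.ofReal ε' := fun A hA => by
    refine (Real.volume_le_diam _).trans (Metric.ediam_le_of_forall_dist_le ?_)
    rintro _ ⟨a, ha, rfl⟩ _ ⟨b, hb, rfl⟩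
    refine (h1 A (hF.mem_toFinset.1 hA) a ha.2 b hb.2 ?_).le
    have := (Metric.edist_le_ediam_of_mem ha.1 hb.1).trans_lt hdiam
    rwa [edist_dist, ENNReal.ofReal_lt_ofReal_iff hr] at this
  have hvol : ENNReal.ofReal (dist (f x) (f y)) ≤ ENNReal.ofReal (m * ε') := by
    calc ENNReal.ofReal (dist (f x) (f y)) = volume (uIcc (f x) (f y)) := by
          rw [uIcc, Real.volume_Icc, max_sub_min_eq_abs, dist_comm, Real.dist_eq]
      _ ≤ volume (⋃ A ∈ hF.toFinset, f '' (C ∩ A)) := measure_mono hsub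
      _ ≤ ∑ A ∈ hF.toFinset, volume (f '' (C ∩ A)) := measure_biUnion_finset_le _ _
      _ ≤ ∑ A ∈ hF.toFinset, ENNReal.ofReal ε' := Finset.sum_le_sum hpiece
      _ = ENNReal.ofReal (m * ε') := by
          rw [Finset.sum_const, nsmul_eq_mul, ENNReal.ofReal_mul (Nat.cast_nonneg _),
            ENNReal.ofReal_natCast]
  rw [ENNReal.ofReal_le_ofReal_iff (by positivity)] at hvol
  refine hvol.trans_lt ?_
  have : (m + 1) * ε' = ε := by rw [hε']; field_simp
  linarith

theorem isStraight_of_forall_uniformContinuous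
    (h : ∀ F : Set (Set X), F.Finite → ⋃₀ F = univ → ∀ f : X → ℝ, Continuous f →
      (∀ C ∈ F, UniformContinuousOn f C) → UniformContinuous f) : IsStraight X :=
  fun F hF _ hcov f hf => ⟨fun hu _ _ => hu.uniformContinuousOn, h F hF hcov f hf⟩

theorem IsULC.isStraight (hX : IsULC X) : IsStraight X := by
  refine isStraight_of_forall_uniformContinuous fun F hF hcov f hf huc =>
    Metric.uniformContinuous_iff.2 fun ε hε => ?_
  obtain ⟨r, hr, h⟩ := exists_forall_isConnected_dist_lt hF hcov hf huc hε
  obtain ⟨δ, hδ, hC⟩ := hX r hr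
  refine ⟨δ, hδ, fun {x y} hxy => ?_⟩
  obtain ⟨C, h1, h2, h3, h4⟩ := hC x y hxy
  exact h C h1 h4 x h2 y h3

theorem exists_separated_seq (hX : ¬ IsPrecompact X) :
    ∃ s > 0, ∃ p : ℕ → X, ∀ i j, i ≠ j → s ≤ dist (p i) (p j) := by
  rw [IsPrecompact, Metric.totallyBounded_iff] at hX
  push Not at hX
  obtain ⟨s, hs, h⟩ := hX
  have : Std.Symm fun x y : X => s ≤ dist x y := ⟨fun x y h => by rwa [dist_comm]⟩
  obtain ⟨p, -, hp⟩ := exists_seq_of_forall_finset_exists' (fun _ : X => True)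
    (fun x y => s ≤ dist x y) fun t _ => by
      obtain ⟨y, -, hy⟩ := not_subset.1 (h t t.finite_toSet)
      refine ⟨y, trivial, fun x hx => ?_⟩
      by_contra! hlt
      exact hy (mem_biUnion hx (by rwa [Metric.mem_ball, dist_comm]))
  exact ⟨s, hs, p, fun i j hij => hp hij⟩

theorem exists_isClopen_of_not_connectedSpace [Nonempty X] (hX : ¬ ConnectedSpace X) :
    ∃ A : Set X, IsClopen A ∧ A.Nonempty ∧ Aᶜ.Nonempty := by
  by_contra! h
  refine hX ?_
  have : PreconnectedSpace X := preconnectedSpace_iff_clopen.2 fun A hA => by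
    rcases A.eq_empty_or_nonempty with h1 | h1
    · exact .inl h1
    · exact .inr (compl_empty_iff.1 (h A hA h1))
  exact ⟨inferInstance⟩

end Oscillation

/-! ### Straightness of the product. -/

namespace SeqProd

variable {X : ℕ → Type u} [∀ n, MetricSpace (X n)]

theorem isStraight_of_isPrecompact (hX : ∀ n, IsULC (X n)) (hpc : ∀ n, IsPrecompact (X n)) :
    IsStraight (SeqProd X) := by
  refine isStraight_of_forall_uniformContinuous fun F hF hcov f hf huc =>
    Metric.uniformContinuous_iff.2 fun ε hε => ?_
  have hε3 : 0 < ε / 3 := by positivity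
  obtain ⟨r, hr, hosc⟩ := exists_forall_isConnected_dist_lt hF hcov hf huc hε3
  choose δ hδ hC using fun n => hX n (r / 8) (by positivity)
  -- The `δ n` may tend to `0`, so this closeness in all coordinates is not implied by a small
  -- product distance.
  have hclose : ∀ x z : SeqProd X, (∀ n, dist (x n) (z n) < δ n) → dist (f x) (f z) < ε / 3 := by
    intro x z h
    choose C h1 h2 h3 h4 using fun n => hC n (x n) (z n) (h n)
    obtain ⟨N, hN⟩ := exists_two_mul_pow_lt (half_pos hr)
    refine hosc (box C) (isConnected_box h1)
      ((ediam_box_le N (by positivity) fun n _ => h4 n).trans_lt ?_) x h2 z h3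
    rw [ENNReal.ofReal_lt_ofReal_iff hr]
    linarith [hN N le_rfl]
  have hnet : ∀ n, ∃ P : Set (X n), P.Finite ∧ ∀ a, ∃ q ∈ P, dist a q < δ n / 2 := fun n => by
    obtain ⟨P, hP, h⟩ := Metric.totallyBounded_iff.1 (hpc n) _ (half_pos (hδ n))
    exact ⟨P, hP, fun a => by simpa using h (mem_univ a)⟩
  choose P hP p hpP hp using hnet
  obtain ⟨δ₁, hδ₁, hK⟩ := Metric.uniformContinuousOn_iff.1
    ((isCompact_box fun n => (hP n).isCompact).uniformContinuousOn_of_continuous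
      hf.continuousOn) _ hε3
  obtain ⟨N, hN⟩ := exists_two_mul_pow_lt hδ₁
  obtain ⟨δ₂, hδ₂, hN₂⟩ := exists_pos_forall_lt (X := X) N fun n => half_pos (hδ n)
  refine ⟨δ₂, hδ₂, fun {x y} hxy => ?_⟩
  let x' : SeqProd X := fun n => p n (x n)
  -- Reusing the net points of `x` below `N` makes `x'` and `y'` close. The radius `δ n / 2` of the
  -- nets leaves room for `y n` to be `δ n`-close to them.
  let y' : SeqProd X := fun n => if n < N then p n (x n) else p n (y n)
  have hx' : dist (f x) (f x') < ε / 3 :=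
    hclose x x' fun n => (hp n (x n)).trans (half_lt_self (hδ n))
  have hy' : dist (f y) (f y') < ε / 3 := by
    refine hclose y y' fun n => ?_
    dsimp only [y']
    split_ifs with hn
    · have h1 := hN₂ x y hxy n hn
      have h2 := hp n (x n)
      have h3 := dist_triangle_left (y n) (p n (x n)) (x n)
      linarith
    · exact (hp n (y n)).trans (half_lt_self (hδ n))
  have hxy' : dist (f x') (f y') < ε / 3 := by
    refine hK x' (fun n => hpP n _) y' (fun n => ?_) ?_
    · dsimp only [y']
      split_ifs <;> exact hpP n _
    · have := dist_le_of_forall_lt (x := x') (y := y') N le_rfl fun n hn => by simp [x', y', hn]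
      linarith [hN N le_rfl]
  have h1 := dist_triangle4 (f x) (f x') (f y') (f y)
  rw [dist_comm (f y') (f y)] at h1
  linarith

open Classical in
theorem not_isStraight [∀ n, Nonempty (X n)] (hinf : ¬ {n : ℕ | ¬ ConnectedSpace (X n)}.Finite)
    {m : ℕ} (hm : ¬ IsPrecompact (X m)) : ¬ IsStraight (SeqProd X) := by
  intro hS
  obtain ⟨s, hs, p, hp⟩ := exists_separated_seq hm
  have hex : ∀ k : ℕ, ∃ n, k ≤ n ∧ n ≠ m ∧ ¬ ConnectedSpace (X n) := fun k => by
    obtain ⟨n, hn, hlt⟩ := Set.Infinite.exists_gt hinf (max k m)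
    exact ⟨n, (le_max_left _ _).trans hlt.le, ((le_max_right _ _).trans_lt hlt).ne', hn⟩
  choose ν hkν hνm hν using hex
  choose A hA hAne hAne' using fun k => exists_isClopen_of_not_connectedSpace (hν k)
  choose a ha using hAne
  choose b hb using hAne'
  -- A bump equal to `1` on the sequence and `0` at distance at least `s / 3` from it.
  let h : X m → ℝ := fun t => max 0 (1 - 3 / s * Metric.infDist t (range p))
  have hne : (range p).Nonempty := range_nonempty p
  have hh : UniformContinuous h := by
    have h1 : LipschitzWith (Real.toNNReal (3 / s)) h := by
      refine LipschitzWith.const_max (LipschitzWith.of_dist_le_mul fun t u => ?_) 0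
      rw [Real.coe_toNNReal _ (by positivity), Real.dist_eq, sub_sub_sub_cancel_left, ← mul_sub,
        abs_mul, abs_of_pos (by positivity : 0 < 3 / s), abs_sub_comm, ← Real.dist_eq]
      refine mul_le_mul_of_nonneg_left ?_ (by positivity)
      simpa using (Metric.lipschitz_infDist_pt (range p)).dist_le_mul t u
    exact h1.uniformContinuous
  have hh0 : ∀ t, (∀ k, s / 3 ≤ dist t (p k)) → h t = 0 := fun t ht => by
    have h1 : s / 3 ≤ Metric.infDist t (range p) :=
      (Metric.le_infDist hne).2 (by rintro _ ⟨k, rfl⟩; exact ht k)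
    refine max_eq_left ?_
    have h2 := mul_le_mul_of_nonneg_left h1 (by positivity : 0 ≤ 3 / s)
    have h3 : 3 / s * (s / 3) = 1 := by field_simp
    linarith
  have hev : ∀ n, Continuous fun x : SeqProd X => x n := fun n =>
    (uniformContinuous_eval n).continuous
  have hclosed : ∀ B : ∀ k, Set (X (ν k)), (∀ k, IsClosed (B k)) →
      IsClosed {x : SeqProd X | ∀ k, x (ν k) ∈ B k ∨ s / 3 ≤ dist (x m) (p k)} := fun B hB => by
    simp only [ofPred_forall, ofPred_or]
    exact isClosed_iInter fun k => ((hB k).preimage (hev _)).union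
      (isClosed_le continuous_const ((hev m).dist continuous_const))
  let F₁ : Set (SeqProd X) := {x | ∀ k, x (ν k) ∈ A k ∨ s / 3 ≤ dist (x m) (p k)}
  let F₂ : Set (SeqProd X) := {x | ∀ k, x (ν k) ∈ (A k)ᶜ ∨ s / 3 ≤ dist (x m) (p k)}
  have hF₁ : IsClosed F₁ := hclosed A fun k => (hA k).isClosed
  have hF₂ : IsClosed F₂ := hclosed (fun k => (A k)ᶜ) fun k => (hA k).compl.isClosed
  -- By `s`-separation, `x m` is within `s / 3` of at most one `p k`, so only one clopen splitting
  -- constrains `x`.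
  have hcov : F₁ ∪ F₂ = univ := by
    refine eq_univ_of_forall fun x => ?_
    by_contra hx
    simp only [F₁, F₂, mem_union, mem_ofPred_eq, not_or, not_forall, not_le] at hx
    obtain ⟨⟨i, hi, hi'⟩, j, hj, hj'⟩ := hx
    have hij : i ≠ j := by rintro rfl; exact hj hi
    have h1 := dist_triangle_left (p i) (p j) (x m)
    linarith [hp i j hij]
  let f : SeqProd X → ℝ := fun x => if x ∈ F₂ then 0 else h (x m)
  have hf₂ : EqOn f (fun _ => 0) F₂ := fun x hx => if_pos hx
  have hf₁ : EqOn f (fun x => h (x m)) F₁ := fun x hx => by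
    by_cases hx₂ : x ∈ F₂
    · rw [hf₂ hx₂]
      -- On `F₁ ∩ F₂` no `p k` is within `s / 3` of `x m`, so the bump vanishes and the two
      -- definitions agree.
      exact (hh0 _ fun k => (hx k).elim (fun h1 => (hx₂ k).resolve_left fun h2 => h2 h1) id).symm
    · exact if_neg hx₂
  have hu₁ : UniformContinuousOn f F₁ :=
    ((hh.comp (uniformContinuous_eval m)).uniformContinuousOn).congr hf₁.symm
  have hu₂ : UniformContinuousOn f F₂ :=
    (uniformContinuous_const.uniformContinuousOn).congr hf₂.symm
  have hf : Continuous f := by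
    rw [← continuousOn_univ, ← hcov]
    exact hu₁.continuousOn.union_of_isClosed hu₂.continuousOn hF₁ hF₂
  have huc : UniformContinuous f := by
    refine (hS {F₁, F₂} (toFinite _) ?_ (by simpa using hcov) f hf).2 ?_
    · rintro C (rfl | rfl) <;> assumption
    · rintro C (rfl | rfl) <;> assumption
  obtain ⟨δ, hδ, hfδ⟩ := Metric.uniformContinuous_iff.1 huc 1 one_pos
  obtain ⟨N, hN⟩ := exists_two_mul_pow_lt hδ
  let x₀ : SeqProd X := update (fun n => Classical.arbitrary (X n)) m (p N)
  have hm' : ∀ c, update x₀ (ν N) c m = p N := fun c => by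
    rw [update_of_ne _ (hνm N).symm]
    exact update_self ..
  -- Switching coordinate `ν N ≥ N` across its splitting moves the point by less than `δ` but takes
  -- `f` from `1` to `0`.
  have hlt := hfδ ((dist_update_le x₀ (ν N) (a N) (b N)).trans_lt (hN _ (hkν N)))
  have hfar : ∀ k, k ≠ N → s / 3 ≤ dist (p N) (p k) := fun k hk => by
    linarith [hp N k hk.symm]
  have hxa : update x₀ (ν N) (a N) ∈ F₁ := fun k => by
    by_cases hk : k = N
    · subst hk
      exact .inl (by simpa using ha k)
    · right
      simpa only [hm'] using hfar k hk
  have hxb : update x₀ (ν N) (b N) ∈ F₂ := fun k => by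
    by_cases hk : k = N
    · subst hk
      exact .inl (by simpa using hb k)
    · right
      simpa only [hm'] using hfar k hk
  have hpN : h (p N) = 1 := by
    simp [h, Metric.infDist_zero_of_mem (mem_range_self N)]
  rw [hf₁ hxa, hf₂ hxb] at hlt
  simp only [hm', hpN] at hlt
  norm_num at hlt

end SeqProd

theorem theoremB (X : ℕ → Type u) [∀ n, MetricSpace (X n)] [∀ n, Nonempty (X n)]
    (hX : ∀ n, IsULC (X n)) :
    (IsULC (SeqProd X) ↔ {n : ℕ | ¬ ConnectedSpace (X n)}.Finite) ∧
    (IsStraight (SeqProd X) ↔ IsULC (SeqProd X) ∨ ∀ n, IsPrecompact (X n)) := by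
  refine ⟨⟨SeqProd.finite_of_isULC, SeqProd.isULC_of_finite hX⟩, fun h => ?_, ?_⟩
  · by_contra! hc
    obtain ⟨hU, m, hm⟩ := hc
    exact SeqProd.not_isStraight (fun hfin => hU (SeqProd.isULC_of_finite hX hfin)) hm h
  · rintro (h | h)
    · exact h.isStraight
    · exact SeqProd.isStraight_of_isPrecompact hX h
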